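/- Let $\mathcal H$ be a complex Hilbert space with an orthonormal basis $\{e_i : i\in\Theta\}$, where $\Theta$ is countable (finite or infinite) with at least two elements, and let $\omega=(\omega_i)_{i\in\Theta}$ be positive real numbers with $\sum_{i\in\Theta}\omega_i=1$. Let $\mathcal F(\mathcal H)=\bigoplus_{n\ge 0}\mathcal H^{\otimes n}$ be the full Fock space, $\mathcal H^{\otimes 0}=\mathbb C$, with vacuum vector $\Omega\in\mathcal H^{\otimes 0}=\mathbb C$, $|\Omega|=1$; let $l_i$ be the left creation operator $l_i(\eta)=e_i\otimes\eta$ on $\mathcal F(\mathcal H)$, and put $$P_\omega(x)=\sum_{i\in\Theta}\omega_i\, l_i^*\,x\,l_i,\qquad x\in B(\mathcal F(\mathcal H)).$$ Let $H^\infty=\{x\in B(\mathcal F(\mathcal H)) : P_\omega(x)=x\}$ be the noncommutative Poisson boundary, that is, the von Neumann algebra whose linear structure, involution, unit and norm are those of $B(\mathcal F(\mathcal H))$ and whose product is the Choi–Effros product $x\circ y=E(xy)$, where $E(x)=\lim_{n\to\kappa}\frac1n\sum_{k=0}^{n-1}P_\omega^k(x)$ (limit in the weak operator topology) for a free ultrafilter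 $\kappa$ on $\mathbb N$. Then, for every choice of $\kappa$, the linear functional $$\varphi: H^\infty\to\mathbb C,\qquad \varphi(x)=\langle x\Omega,\Omega\rangle,$$ is a faithful normal state on the von Neumann algebra $H^\infty$: $\varphi$ is positive, $\varphi(1)=1$, $\varphi(x)=0$ for a positive element $x$ of $H^\infty$ only if $x=0$, and $\varphi(\sup D)=\sup\varphi(D)$ for every nonempty upward directed set $D$ of self-adjoint elements of $H^\infty$ that has a least upper bound $\sup D$ in $H^\infty$ (positivity and order being those of the von Neumann algebra $H^\infty$). -/

import Mathlib

open Filter Topology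
open scoped ComplexOrder TensorProduct

set_option linter.unusedSectionVars false

noncomputable section

namespace Poisson

universe u

section Boundary

variable {K : Type u} [NormedAddCommGroup K] [InnerProductSpace ℂ K] [CompleteSpace K]

/-- `T` is the limit of the family `a` along the filter `F` in the weak operator topology. -/
def IsWeakLimit {ι : Type*} (F : Filter ι) (a : ι → K →L[ℂ] K) (T : K →L[ℂ] K) : Prop :=
  ∀ ξ η : K, Tendsto (fun i => inner ℂ η (a i ξ)) F (𝓝 (inner ℂ η (T ξ)))

theorem IsWeakLimit.unique {ι : Type*} {F : Filter ι} [F.NeBot] {a : ι → K →L[ℂ] K}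
    {S T : K →L[ℂ] K} (hS : IsWeakLimit F a S) (hT : IsWeakLimit F a T) : S = T := by
  ext ξ
  exact ext_inner_left ℂ fun η => tendsto_nhds_unique (hS ξ η) (hT ξ η)

theorem IsWeakLimit.add {ι : Type*} {F : Filter ι} {a b : ι → K →L[ℂ] K}
    {S T : K →L[ℂ] K} (hS : IsWeakLimit F a S) (hT : IsWeakLimit F b T) :
    IsWeakLimit F (fun i => a i + b i) (S + T) := fun ξ η => by
  simpa [inner_add_right] using (hS ξ η).add (hT ξ η)

theorem IsWeakLimit.smul {ι : Type*} {F : Filter ι} {a : ι → K →L[ℂ] K}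
    {S : K →L[ℂ] K} (c : ℂ) (hS : IsWeakLimit F a S) :
    IsWeakLimit F (fun i => c • a i) (c • S) := fun ξ η => by
  simpa [inner_smul_right] using (hS ξ η).const_mul c

theorem IsWeakLimit.star {ι : Type*} {F : Filter ι} {a : ι → K →L[ℂ] K}
    {S : K →L[ℂ] K} (hS : IsWeakLimit F a S) :
    IsWeakLimit F (fun i => star (a i)) (star S) := fun ξ η => by
  have h := (Complex.continuous_conj.tendsto _).comp (hS η ξ)
  simpa [ContinuousLinearMap.star_eq_adjoint, ContinuousLinearMap.adjoint_inner_right,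
    Function.comp_def] using h

theorem IsWeakLimit.norm_le {ι : Type*} {F : Filter ι} [F.NeBot] {a : ι → K →L[ℂ] K}
    {S : K →L[ℂ] K} (hS : IsWeakLimit F a S) {C : ℝ} (hC : 0 ≤ C)
    (h : ∀ᶠ i in F, ‖a i‖ ≤ C) : ‖S‖ ≤ C := by
  refine ContinuousLinearMap.opNorm_le_of_re_inner_le hC fun ξ η hξ hη => ?_
  have h1 : Tendsto (fun i => RCLike.re (inner ℂ (a i ξ) η)) F
      (𝓝 (RCLike.re (inner ℂ (S ξ) η))) := by
    have := (Complex.continuous_re.tendsto _).comp (hS ξ η)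
    simpa [Function.comp_def, inner_re_symm] using this
  refine le_of_tendsto h1 ?_
  filter_upwards [h] with i hi
  calc RCLike.re (inner ℂ (a i ξ) η) ≤ ‖a i ξ‖ * ‖η‖ := re_inner_le_norm _ _
    _ ≤ C * ‖ξ‖ * ‖η‖ := by gcongr; exact (a i).le_of_opNorm_le hi ξ
    _ = C := by simp [hξ, hη]

theorem exists_isWeakLimit {ι : Type*} (F : Ultrafilter ι) (a : ι → K →L[ℂ] K) (C : ℝ)
    (h : ∀ᶠ i in (F : Filter ι), ‖a i‖ ≤ C) : ∃ T, IsWeakLimit (F : Filter ι) a T := by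
  have hb : ∀ ξ η : K, ∀ᶠ i in (F : Filter ι), ‖inner ℂ (a i ξ) η‖ ≤ C * ‖ξ‖ * ‖η‖ := by
    intro ξ η
    filter_upwards [h] with i hi
    exact (norm_inner_le_norm _ _).trans (by gcongr; exact (a i).le_of_opNorm_le hi ξ)
  have hlim : ∀ ξ η : K, ∃ z : ℂ, Tendsto (fun i => inner ℂ (a i ξ) η) F (𝓝 z) := by
    intro ξ η
    obtain ⟨z, -, hz⟩ := (isCompact_closedBall (0 : ℂ) (C * ‖ξ‖ * ‖η‖)).ultrafilter_le_nhds
      (F.map fun i => inner ℂ (a i ξ) η) (by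
        rw [le_principal_iff, Ultrafilter.mem_coe, Ultrafilter.mem_map]
        refine Filter.mem_of_superset (hb ξ η) fun i hi => ?_
        simpa using hi)
    exact ⟨z, hz⟩
  choose B hB using hlim
  have hBn : ∀ ξ η, ‖B ξ η‖ ≤ C * ‖ξ‖ * ‖η‖ := fun ξ η =>
    le_of_tendsto (hB ξ η).norm (hb ξ η)
  let B' : K →L⋆[ℂ] K →L[ℂ] ℂ := LinearMap.mkContinuous₂ (LinearMap.mk₂'ₛₗ _ _ B
    (fun x y z => tendsto_nhds_unique (hB _ _) (by
      simpa [inner_add_left] using (hB x z).add (hB y z)))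
    (fun c x z => tendsto_nhds_unique (hB _ _) (by
      simpa [inner_smul_left, mul_comm] using (hB x z).const_mul ((starRingEnd ℂ) c)))
    (fun x y z => tendsto_nhds_unique (hB _ _) (by
      simpa [inner_add_right] using (hB x y).add (hB x z)))
    (fun c x z => tendsto_nhds_unique (hB _ _) (by
      simpa [inner_smul_right] using (hB x z).const_mul c))) C hBn
  refine ⟨InnerProductSpace.continuousLinearMapOfBilin B', fun ξ η => ?_⟩
  have h1 : inner ℂ (InnerProductSpace.continuousLinearMapOfBilin B' ξ) η = B ξ η := by
    rw [InnerProductSpace.continuousLinearMapOfBilin_apply]; rfl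
  have h2 := (Complex.continuous_conj.tendsto _).comp (hB ξ η)
  rw [← h1] at h2
  rw [inner_conj_symm] at h2
  simpa [Function.comp_def] using h2

/-- A family of positive weights with sum `1`. -/
structure Weights (Θ : Type*) where
  /-- The weights. -/
  val : Θ → ℝ
  pos : ∀ i, 0 < val i
  hasSum : HasSum val 1

/-- A free ultrafilter on `ℕ`: one that contains every cofinite set. -/
structure FreeUltrafilter where
  /-- The ultrafilter. -/
  val : Ultrafilter ℕ
  free : (val : Filter ℕ) ≤ cofinite

section Markov

variable {Θ : Type*} (ω : Weights Θ) (V : Θ → K →ₗᵢ[ℂ] K)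

/-- The operator `V_i^* x V_i`. -/
def compress (i : Θ) (x : K →L[ℂ] K) : K →L[ℂ] K :=
  ContinuousLinearMap.adjoint (V i).toContinuousLinearMap ∘L x ∘L (V i).toContinuousLinearMap

theorem inner_compress (i : Θ) (x : K →L[ℂ] K) (ξ η : K) :
    inner ℂ η (compress V i x ξ) = inner ℂ (V i η) (x (V i ξ)) := by
  simp [compress, ContinuousLinearMap.adjoint_inner_right]

theorem norm_compress_le (i : Θ) (x : K →L[ℂ] K) : ‖compress V i x‖ ≤ ‖x‖ := by
  refine ContinuousLinearMap.opNorm_le_of_re_inner_le (norm_nonneg _) fun ξ η hξ hη => ?_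
  rw [inner_re_symm, inner_compress]
  calc RCLike.re (inner ℂ (V i η) (x (V i ξ))) ≤ ‖V i η‖ * ‖x (V i ξ)‖ := re_inner_le_norm _ _
    _ ≤ ‖V i η‖ * (‖x‖ * ‖V i ξ‖) := by gcongr; exact x.le_opNorm _
    _ = ‖x‖ := by simp [hξ, hη]

theorem compress_add (i : Θ) (x y : K →L[ℂ] K) :
    compress V i (x + y) = compress V i x + compress V i y := by
  ext; simp [compress]

theorem compress_smul (i : Θ) (c : ℂ) (x : K →L[ℂ] K) :
    compress V i (c • x) = c • compress V i x := by
  ext; simp [compress]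

theorem norm_term_le (x : K →L[ℂ] K) (i : Θ) :
    ‖(ω.val i : ℂ) • compress V i x‖ ≤ ω.val i * ‖x‖ := by
  rw [norm_smul, Complex.norm_real, Real.norm_of_nonneg (ω.pos i).le]
  exact mul_le_mul_of_nonneg_left (norm_compress_le V i x) (ω.pos i).le

theorem summable_term (x : K →L[ℂ] K) :
    Summable fun i => (ω.val i : ℂ) • compress V i x :=
  Summable.of_norm_bounded (ω.hasSum.summable.mul_right ‖x‖) (norm_term_le ω V x)

/-- The unital completely positive map `P(x) = ∑ ω_i V_i^* x V_i`. The series converges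
absolutely in norm, since `∑ ω_i = 1`. -/
def markov : (K →L[ℂ] K) →ₗ[ℂ] (K →L[ℂ] K) where
  toFun x := ∑' i, (ω.val i : ℂ) • compress V i x
  map_add' x y := by
    simp only [compress_add, smul_add]
    exact (summable_term ω V x).tsum_add (summable_term ω V y)
  map_smul' c x := by
    simp only [compress_smul, RingHom.id_apply]
    rw [← (summable_term ω V x).tsum_const_smul]
    exact tsum_congr fun i => smul_comm _ _ _

theorem hasSum_inner_markov (x : K →L[ℂ] K) (ξ η : K) :
    HasSum (fun i => (ω.val i : ℂ) * inner ℂ (V i η) (x (V i ξ)))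
      (inner ℂ η (markov ω V x ξ)) := by
  have h := ((innerSL ℂ η).hasSum
    ((ContinuousLinearMap.apply ℂ K ξ).hasSum (summable_term ω V x).hasSum))
  simpa [markov, inner_smul_right, inner_compress] using h

theorem norm_markov_le (x : K →L[ℂ] K) : ‖markov ω V x‖ ≤ ‖x‖ := by
  have := tsum_of_norm_bounded (ω.hasSum.mul_right ‖x‖) (norm_term_le ω V x)
  simpa [markov] using this

/-- Weak operator convergence of bounded families is preserved by `P`. -/
theorem IsWeakLimit.markov {ι : Type*} {F : Filter ι} [F.NeBot] {a : ι → K →L[ℂ] K}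
    {S : K →L[ℂ] K} (hS : IsWeakLimit F a S) (C : ℝ) (h : ∀ᶠ i in F, ‖a i‖ ≤ C) :
    IsWeakLimit F (fun i => markov ω V (a i)) (markov ω V S) := by
  intro ξ η
  have hC : 0 ≤ C := by
    obtain ⟨i, hi⟩ := h.exists
    exact (norm_nonneg _).trans hi
  rw [← (hasSum_inner_markov ω V S ξ η).tsum_eq]
  simp only [← (hasSum_inner_markov ω V _ ξ η).tsum_eq]
  refine tendsto_tsum_of_dominated_convergence
    (bound := fun i => ω.val i * (‖η‖ * (C * ‖ξ‖))) (ω.hasSum.summable.mul_right _)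
    (fun i => (hS _ _).const_mul _) ?_
  filter_upwards [h] with j hj i
  rw [norm_mul, Complex.norm_real, Real.norm_of_nonneg (ω.pos i).le]
  refine mul_le_mul_of_nonneg_left ?_ (ω.pos i).le
  refine (norm_inner_le_norm _ _).trans ?_
  rw [(V i).norm_map]
  gcongr
  simpa using (a j).le_of_opNorm_le hj (V i ξ)

/-- A map with the properties of a unital completely positive contraction that are used to
build the multiplication of the boundary. -/
structure IsUCPLike (T : (K →L[ℂ] K) →ₗ[ℂ] (K →L[ℂ] K)) : Prop where
  map_one : T 1 = 1
  map_star : ∀ x, T (star x) = star (T x)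
  norm_le : ∀ x, ‖T x‖ ≤ ‖x‖
  schwarz : ∀ x ξ y, 0 ≤ RCLike.re (inner ℂ ξ (T (star x * x) ξ))
    - 2 * RCLike.re (inner ℂ y (T x ξ)) + ‖y‖ ^ 2

theorem IsUCPLike.kadison {T : (K →L[ℂ] K) →ₗ[ℂ] (K →L[ℂ] K)} (hT : IsUCPLike T)
    (x : K →L[ℂ] K) : star (T x) * T x ≤ T (star x * x) := by
  rw [← sub_nonneg, ContinuousLinearMap.nonneg_iff_isPositive]
  rw [ContinuousLinearMap.isPositive_def']
  refine ⟨?_, fun ξ => ?_⟩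
  · simp [IsSelfAdjoint, ← hT.map_star]
  · have h := hT.schwarz x ξ (T x ξ)
    rw [inner_self_eq_norm_sq] at h
    rw [ContinuousLinearMap.reApplyInnerSelf_apply, inner_re_symm]
    have h2 : RCLike.re (inner ℂ ξ ((star (T x) * T x) ξ)) = ‖T x ξ‖ ^ 2 := by
      simp [ContinuousLinearMap.star_eq_adjoint, ContinuousLinearMap.adjoint_inner_right]
      norm_cast
    rw [sub_apply, inner_sub_right, map_sub, h2]
    linarith

theorem IsUCPLike.mono {T : (K →L[ℂ] K) →ₗ[ℂ] (K →L[ℂ] K)} (hT : IsUCPLike T)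
    {x y : K →L[ℂ] K} (h : x ≤ y) : T x ≤ T y := by
  rw [← sub_nonneg] at h
  obtain ⟨z, hz⟩ := CStarAlgebra.nonneg_iff_eq_star_mul_self.1 h
  rw [← sub_nonneg, ← map_sub, hz]
  exact (star_mul_self_nonneg _).trans (hT.kadison z)

theorem re_inner_le_of_le {x y : K →L[ℂ] K} (h : x ≤ y) (ξ : K) :
    RCLike.re (inner ℂ ξ (x ξ)) ≤ RCLike.re (inner ℂ ξ (y ξ)) := by
  have h1 := ((ContinuousLinearMap.nonneg_iff_isPositive _).1 (sub_nonneg.2 h)).re_inner_nonneg_right ξ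
  rw [sub_apply, inner_sub_right, map_sub] at h1
  linarith

theorem IsUCPLike.comp {S T : (K →L[ℂ] K) →ₗ[ℂ] (K →L[ℂ] K)} (hS : IsUCPLike S)
    (hT : IsUCPLike T) : IsUCPLike (S ∘ₗ T) where
  map_one := by simp [hS.map_one, hT.map_one]
  map_star x := by simp [hS.map_star, hT.map_star]
  norm_le x := (hS.norm_le _).trans (hT.norm_le _)
  schwarz x ξ y := by
    have h1 := hS.schwarz (T x) ξ y
    have h2 := re_inner_le_of_le (hS.mono (hT.kadison x)) ξ
    simp only [LinearMap.comp_apply]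
    linarith

theorem isUCPLike_id : IsUCPLike (LinearMap.id : (K →L[ℂ] K) →ₗ[ℂ] (K →L[ℂ] K)) where
  map_one := rfl
  map_star _ := rfl
  norm_le _ := le_rfl
  schwarz x ξ y := by
    have h1 : RCLike.re (inner ℂ ξ ((star x * x) ξ)) = ‖x ξ‖ ^ 2 := by
      simp [ContinuousLinearMap.star_eq_adjoint, ContinuousLinearMap.adjoint_inner_right]
      norm_cast
    have h2 := norm_sub_sq (𝕜 := ℂ) y (x ξ)
    simp only [LinearMap.id_apply, h1]
    nlinarith [sq_nonneg ‖y - x ξ‖]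

theorem isUCPLike_markov : IsUCPLike (markov ω V) where
  map_one := by
    ext ξ
    refine ext_inner_left ℂ fun η => ?_
    refine (hasSum_inner_markov ω V 1 ξ η).unique ?_
    have h := (Complex.hasSum_ofReal.2 ω.hasSum).mul_right (inner ℂ η ξ)
    simpa using h
  map_star x := by
    ext ξ
    refine ext_inner_left ℂ fun η => ?_
    refine (hasSum_inner_markov ω V (star x) ξ η).unique ?_
    have h := (Complex.hasSum_conj'.2 (hasSum_inner_markov ω V x η ξ))
    simpa [ContinuousLinearMap.star_eq_adjoint, ContinuousLinearMap.adjoint_inner_right] using h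
  norm_le := norm_markov_le ω V
  schwarz x ξ y := by
    have h1 := (Complex.hasSum_re (hasSum_inner_markov ω V (star x * x) ξ ξ))
    have h2 := (Complex.hasSum_re (hasSum_inner_markov ω V x ξ y))
    have h3 := (h1.sub (h2.mul_left 2)).add (ω.hasSum.mul_right (‖y‖ ^ 2))
    rw [one_mul] at h3
    refine h3.nonneg fun i => ?_
    have h4 := (isUCPLike_id (K := K)).schwarz x (V i ξ) (V i y)
    rw [(V i).norm_map] at h4
    have h5 := mul_nonneg (ω.pos i).le h4
    simp only [Complex.re_ofReal_mul, LinearMap.id_apply] at h5 ⊢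
    refine h5.trans (le_of_eq ?_)
    simp only [RCLike.re_to_complex]
    ring

/-- The averages `(1/n) ∑_{k<n} P^k(x)`. -/
def cesaro (n : ℕ) : (K →L[ℂ] K) →ₗ[ℂ] (K →L[ℂ] K) :=
  (n : ℂ)⁻¹ • ∑ k ∈ Finset.range n, (markov ω V) ^ k

theorem isUCPLike_pow (k : ℕ) : IsUCPLike ((markov ω V) ^ k) := by
  induction k with
  | zero => exact isUCPLike_id
  | succ k ih => rw [pow_succ]; exact ih.comp (isUCPLike_markov ω V)

theorem cesaro_apply (n : ℕ) (x : K →L[ℂ] K) :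
    cesaro ω V n x = (n : ℂ)⁻¹ • ∑ k ∈ Finset.range n, ((markov ω V) ^ k) x := by
  simp [cesaro]

theorem isUCPLike_cesaro {n : ℕ} (hn : n ≠ 0) : IsUCPLike (cesaro ω V n) where
  map_one := by
    simp only [cesaro_apply, (isUCPLike_pow ω V _).map_one, Finset.sum_const, Finset.card_range]
    rw [← Nat.cast_smul_eq_nsmul ℂ, smul_smul, inv_mul_cancel₀ (by exact_mod_cast hn), one_smul]
  map_star x := by
    simp [cesaro_apply, (isUCPLike_pow ω V _).map_star]
  norm_le x := by
    rw [cesaro_apply, norm_smul, norm_inv, Complex.norm_natCast]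
    have h : ‖∑ k ∈ Finset.range n, ((markov ω V) ^ k) x‖ ≤ n * ‖x‖ := by
      refine (norm_sum_le_of_le _ fun k _ => (isUCPLike_pow ω V k).norm_le x).trans ?_
      simp
    have hn' : (0 : ℝ) < n := by exact_mod_cast Nat.pos_of_ne_zero hn
    calc (n : ℝ)⁻¹ * _ ≤ (n : ℝ)⁻¹ * (n * ‖x‖) := by gcongr
      _ = ‖x‖ := by field_simp
  schwarz x ξ y := by
    have hn' : (n : ℝ) ≠ 0 := by exact_mod_cast hn
    have key : ∀ (z : K →L[ℂ] K) (a b : K), RCLike.re (inner ℂ a (cesaro ω V n z b)) =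
        (n : ℝ)⁻¹ * ∑ k ∈ Finset.range n, RCLike.re (inner ℂ a (((markov ω V) ^ k) z b)) := by
      intro z a b
      rw [cesaro_apply, smul_apply, sum_apply, inner_smul_right,
        inner_sum]
      have : (n : ℂ)⁻¹ = ((n : ℝ)⁻¹ : ℝ) := by push_cast; rfl
      rw [this]
      simp
    have h : 0 ≤ (n : ℝ)⁻¹ * ∑ k ∈ Finset.range n,
        (RCLike.re (inner ℂ ξ (((markov ω V) ^ k) (star x * x) ξ))
          - 2 * RCLike.re (inner ℂ y (((markov ω V) ^ k) x ξ)) + ‖y‖ ^ 2) :=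
      mul_nonneg (by positivity)
        (Finset.sum_nonneg fun k _ => (isUCPLike_pow ω V k).schwarz x ξ y)
    rw [key, key]
    simp only [Finset.sum_add_distrib, Finset.sum_sub_distrib, ← Finset.mul_sum,
      Finset.sum_const, Finset.card_range, nsmul_eq_mul] at h
    have e : (n : ℝ)⁻¹ * (n * ‖y‖ ^ 2) = ‖y‖ ^ 2 := by field_simp
    rw [mul_add, mul_sub, e] at h
    linarith

theorem norm_cesaro_le (n : ℕ) (x : K →L[ℂ] K) : ‖cesaro ω V n x‖ ≤ ‖x‖ := by
  rcases eq_or_ne n 0 with rfl | hn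
  · simp [cesaro_apply]
  · exact (isUCPLike_cesaro ω V hn).norm_le x

variable (κ : FreeUltrafilter)

theorem exists_expectation (x : K →L[ℂ] K) :
    ∃ T, IsWeakLimit (κ.val : Filter ℕ) (fun n => cesaro ω V n x) T :=
  exists_isWeakLimit κ.val _ ‖x‖ (Eventually.of_forall fun n => norm_cesaro_le ω V n x)

/-- The projection `E(x) = lim_{n → κ} (1/n) ∑_{k<n} P^k(x)` onto the harmonic operators, the
limit being taken in the weak operator topology. -/
def expectationFun (x : K →L[ℂ] K) : K →L[ℂ] K := (exists_expectation ω V κ x).choose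

theorem isWeakLimit_expectationFun (x : K →L[ℂ] K) :
    IsWeakLimit (κ.val : Filter ℕ) (fun n => cesaro ω V n x) (expectationFun ω V κ x) :=
  (exists_expectation ω V κ x).choose_spec

/-- The map `E` as a linear map. -/
def expectation : (K →L[ℂ] K) →ₗ[ℂ] (K →L[ℂ] K) where
  toFun := expectationFun ω V κ
  map_add' x y := by
    refine (isWeakLimit_expectationFun ω V κ (x + y)).unique ?_
    simpa using (isWeakLimit_expectationFun ω V κ x).add (isWeakLimit_expectationFun ω V κ y)
  map_smul' c x := by
    refine (isWeakLimit_expectationFun ω V κ (c • x)).unique ?_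
    simpa using (isWeakLimit_expectationFun ω V κ x).smul c

theorem isWeakLimit_expectation (x : K →L[ℂ] K) :
    IsWeakLimit (κ.val : Filter ℕ) (fun n => cesaro ω V n x) (expectation ω V κ x) :=
  isWeakLimit_expectationFun ω V κ x

theorem FreeUltrafilter.le_atTop : (κ.val : Filter ℕ) ≤ atTop := by
  rw [← Nat.cofinite_eq_atTop]; exact κ.free

theorem eventually_ne_zero : ∀ᶠ n in (κ.val : Filter ℕ), n ≠ 0 :=
  κ.le_atTop (eventually_ne_atTop 0)

theorem isUCPLike_expectation : IsUCPLike (expectation ω V κ) where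
  map_one := by
    refine (isWeakLimit_expectation ω V κ 1).unique fun ξ η => ?_
    refine tendsto_const_nhds.congr' ?_
    filter_upwards [eventually_ne_zero κ] with n hn
    rw [(isUCPLike_cesaro ω V hn).map_one]
  map_star x := by
    refine (isWeakLimit_expectation ω V κ (star x)).unique fun ξ η => ?_
    refine ((isWeakLimit_expectation ω V κ x).star ξ η).congr' ?_
    filter_upwards [eventually_ne_zero κ] with n hn
    rw [(isUCPLike_cesaro ω V hn).map_star]
  norm_le x := (isWeakLimit_expectation ω V κ x).norm_le (norm_nonneg x)
    (Eventually.of_forall fun n => norm_cesaro_le ω V n x)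
  schwarz x ξ y := by
    have h1 := (Complex.continuous_re.tendsto _).comp
      (isWeakLimit_expectation ω V κ (star x * x) ξ ξ)
    have h2 := (Complex.continuous_re.tendsto _).comp (isWeakLimit_expectation ω V κ x ξ y)
    refine ge_of_tendsto ((h1.sub (h2.const_mul 2)).add_const (‖y‖ ^ 2)) ?_
    filter_upwards [eventually_ne_zero κ] with n hn
    exact (isUCPLike_cesaro ω V hn).schwarz x ξ y

/-- The `P`-harmonic operators: the `x` with `P(x) = x`. -/
def harmonic : Submodule ℂ (K →L[ℂ] K) where
  carrier := {x | markov ω V x = x}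
  add_mem' {x y} hx hy := by
    simp only [Set.mem_ofPred_eq] at *
    rw [map_add, hx, hy]
  zero_mem' := map_zero _
  smul_mem' c x hx := by
    simp only [Set.mem_ofPred_eq] at *
    rw [map_smul, hx]

theorem mem_harmonic {x : K →L[ℂ] K} : x ∈ harmonic ω V ↔ markov ω V x = x := Iff.rfl

theorem IsWeakLimit.mem_harmonic {ι : Type*} {F : Filter ι} [F.NeBot] {a : ι → K →L[ℂ] K}
    {S : K →L[ℂ] K} (hS : IsWeakLimit F a S) (C : ℝ) (h : ∀ᶠ i in F, ‖a i‖ ≤ C)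
    (ha : ∀ i, a i ∈ harmonic ω V) : S ∈ harmonic ω V := by
  refine (hS.markov ω V C h).unique ?_
  simpa only [fun i => (Poisson.mem_harmonic ω V).1 (ha i)] using hS

theorem isClosed_harmonic : IsClosed (harmonic ω V : Set (K →L[ℂ] K)) := by
  have hc : Continuous (markov ω V) :=
    ((markov ω V).mkContinuous 1 fun x => by simpa using norm_markov_le ω V x).continuous
  exact isClosed_eq hc continuous_id

theorem pow_apply_of_mem {x : K →L[ℂ] K} (hx : x ∈ harmonic ω V) (k : ℕ) :
    ((markov ω V) ^ k) x = x := by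
  induction k with
  | zero => rfl
  | succ k ih => rw [pow_succ, Module.End.mul_apply, (mem_harmonic ω V).1 hx, ih]

theorem expectation_of_mem {x : K →L[ℂ] K} (hx : x ∈ harmonic ω V) :
    expectation ω V κ x = x := by
  refine (isWeakLimit_expectation ω V κ x).unique fun ξ η => ?_
  refine tendsto_const_nhds.congr' ?_
  filter_upwards [eventually_ne_zero κ] with n hn
  simp only [cesaro_apply, pow_apply_of_mem ω V hx, Finset.sum_const, Finset.card_range]
  rw [← Nat.cast_smul_eq_nsmul ℂ, smul_smul, inv_mul_cancel₀ (by exact_mod_cast hn), one_smul]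

theorem expectation_mem (x : K →L[ℂ] K) : expectation ω V κ x ∈ harmonic ω V := by
  have h1 := (isWeakLimit_expectation ω V κ x).markov ω V ‖x‖
    (Eventually.of_forall fun n => norm_cesaro_le ω V n x)
  refine h1.unique fun ξ η => ?_
  have h2 := isWeakLimit_expectation ω V κ x ξ η
  have h3 : Tendsto (fun n : ℕ => inner ℂ η
      (((n : ℂ)⁻¹ • (((markov ω V) ^ n) x - x)) ξ)) (κ.val : Filter ℕ) (𝓝 0) := by
    have h4 : Tendsto (fun n : ℕ => (n : ℝ)⁻¹ * (‖η‖ * (2 * ‖x‖ * ‖ξ‖))) (κ.val : Filter ℕ)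
        (𝓝 0) := by
      have := (tendsto_inv_atTop_zero.comp (tendsto_natCast_atTop_atTop (R := ℝ))).mul_const
        (‖η‖ * (2 * ‖x‖ * ‖ξ‖))
      rw [zero_mul] at this
      exact this.mono_left κ.le_atTop
    refine squeeze_zero_norm (fun n => ?_) h4
    rw [smul_apply, inner_smul_right, norm_mul, norm_inv, Complex.norm_natCast]
    refine mul_le_mul_of_nonneg_left ((norm_inner_le_norm _ _).trans ?_) (by positivity)
    refine mul_le_mul_of_nonneg_left (ContinuousLinearMap.le_of_opNorm_le _ ?_ ξ) (norm_nonneg _)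
    refine (norm_sub_le _ _).trans ?_
    have := (isUCPLike_pow ω V n).norm_le x
    linarith
  have h5 := h2.add h3
  rw [add_zero] at h5
  refine h5.congr fun n => ?_
  rw [← inner_add_right, ← add_apply]
  congr 2
  simp only [cesaro_apply, map_smul, map_sum, ← smul_add]
  congr 1
  have h6 : ∀ k, markov ω V (((markov ω V) ^ k) x) = ((markov ω V) ^ (k + 1)) x := fun k => by
    rw [pow_succ', Module.End.mul_apply]
  simp only [h6]
  have := Finset.sum_range_succ (fun k => ((markov ω V) ^ k) x) n
  rw [Finset.sum_range_succ'] at this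
  simp only [pow_zero, Module.End.one_apply] at this
  rw [← eq_sub_iff_add_eq] at this
  rw [this]
  abel

theorem star_mem_harmonic {x : K →L[ℂ] K} (hx : x ∈ harmonic ω V) :
    star x ∈ harmonic ω V := by
  rw [mem_harmonic, (isUCPLike_markov ω V).map_star, (mem_harmonic ω V).1 hx]

theorem one_mem_harmonic : (1 : K →L[ℂ] K) ∈ harmonic ω V := (isUCPLike_markov ω V).map_one

theorem expectation_mul_eq_zero {c y : K →L[ℂ] K} (hc : expectation ω V κ c = 0)
    (hy : y ∈ harmonic ω V) : expectation ω V κ (c * y) = 0 := by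
  set E := expectation ω V κ with hE
  have hEu : IsUCPLike E := isUCPLike_expectation ω V κ
  have hEE : ∀ z, E (E z) = E z := fun z =>
    expectation_of_mem ω V κ (expectation_mem ω V κ z)
  have hc' : E (star c) = 0 := by rw [hEu.map_star, hc, star_zero]
  have hEy : E y = y := expectation_of_mem ω V κ hy
  have key : ∀ (t : ℂ) (ξ : K), 0 ≤ 2 * RCLike.re (starRingEnd ℂ t * inner ℂ ξ (E (c * y) ξ))
      + ‖t‖ ^ 2 * RCLike.re (inner ℂ ξ (E (c * star c) ξ)) := by
    intro t ξ
    have h1 := hEu.mono (hEu.kadison (y + t • star c))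
    have h2 : E (y + t • star c) = y := by rw [map_add, map_smul, hc', hEy, smul_zero, add_zero]
    rw [hEE, h2] at h1
    have h3 := re_inner_le_of_le h1 ξ
    have h4 : star (y + t • star c) * (y + t • star c) = star y * y + t • star (c * y)
        + (starRingEnd ℂ t) • (c * y) + (starRingEnd ℂ t * t) • (c * star c) := by
      simp only [star_add, star_smul, star_star, add_mul, mul_add, smul_mul_assoc, mul_smul_comm,
        star_mul, RCLike.star_def, mul_smul]
      rw [smul_add, smul_comm t (starRingEnd ℂ t)]
      abel
    rw [h4] at h3
    simp only [map_add, map_smul, add_apply, smul_apply, inner_add_right,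
      inner_smul_right, hEu.map_star (c * y)] at h3
    have h5 : inner ℂ ξ (star (E (c * y)) ξ) = starRingEnd ℂ (inner ℂ ξ (E (c * y) ξ)) := by
      rw [ContinuousLinearMap.star_eq_adjoint, ContinuousLinearMap.adjoint_inner_right,
        inner_conj_symm]
    rw [h5] at h3
    have h6 : RCLike.re (t * starRingEnd ℂ (inner ℂ ξ (E (c * y) ξ)))
        = RCLike.re (starRingEnd ℂ t * inner ℂ ξ (E (c * y) ξ)) := by
      rw [← RCLike.conj_re, map_mul, RCLike.conj_conj]
    have h7 : RCLike.re (starRingEnd ℂ t * t * inner ℂ ξ (E (c * star c) ξ))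
        = ‖t‖ ^ 2 * RCLike.re (inner ℂ ξ (E (c * star c) ξ)) := by
      rw [RCLike.conj_mul, ← RCLike.ofReal_pow]
      exact RCLike.re_ofReal_mul _ _
    rw [h6, h7] at h3
    linarith
  have h0 : ∀ ξ : K, inner ℂ ξ (E (c * y) ξ) = 0 := by
    intro ξ
    set z := inner ℂ ξ (E (c * y) ξ)
    set r := RCLike.re (inner ℂ ξ (E (c * star c) ξ))
    by_contra hz
    have hz' : 0 < ‖z‖ ^ 2 := by positivity
    -- choose `t = - s z` with `s > 0` small
    have hk : ∀ s : ℝ, 0 ≤ -2 * s * ‖z‖ ^ 2 + s ^ 2 * ‖z‖ ^ 2 * r := by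
      intro s
      have h := key (-(s : ℂ) * z) ξ
      have h1 : starRingEnd ℂ (-(s : ℂ) * z) * z = ((-s * ‖z‖ ^ 2 : ℝ) : ℂ) := by
        rw [map_mul, mul_assoc, Complex.conj_mul']
        push_cast
        simp
      have h2 : ‖-(s : ℂ) * z‖ ^ 2 = s ^ 2 * ‖z‖ ^ 2 := by
        rw [norm_mul, mul_pow, norm_neg, Complex.norm_real, Real.norm_eq_abs, sq_abs]
      change 0 ≤ 2 * RCLike.re (starRingEnd ℂ (-(s : ℂ) * z) * z) + ‖-(s : ℂ) * z‖ ^ 2 * r at h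
      rw [h1, h2] at h
      simp only [RCLike.re_to_complex, Complex.ofReal_re] at h
      linarith
    have hk' := hk (1 / (|r| + 1))
    have hr : 0 < |r| + 1 := by positivity
    have : -2 * (1 / (|r| + 1)) * ‖z‖ ^ 2 + (1 / (|r| + 1)) ^ 2 * ‖z‖ ^ 2 * r
        = (‖z‖ ^ 2 / (|r| + 1) ^ 2) * (-2 * (|r| + 1) + r) := by
      field_simp
    rw [this] at hk'
    have h8 : -2 * (|r| + 1) + r < 0 := by nlinarith [le_abs_self r, abs_nonneg r]
    have h9 : 0 < ‖z‖ ^ 2 / (|r| + 1) ^ 2 := by positivity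
    nlinarith
  have h1 : ((E (c * y)) : K →ₗ[ℂ] K) = 0 := by
    rw [← inner_map_self_eq_zero]
    intro ξ
    rw [← inner_conj_symm]
    simp [h0 ξ]
  ext ξ
  exact congrArg (fun T : K →ₗ[ℂ] K => T ξ) h1

theorem expectation_expectation_mul {x y : K →L[ℂ] K} (hy : y ∈ harmonic ω V) :
    expectation ω V κ (expectation ω V κ x * y) = expectation ω V κ (x * y) := by
  have h := expectation_mul_eq_zero ω V κ (c := x - expectation ω V κ x) (y := y)
    (by rw [map_sub, expectation_of_mem ω V κ (expectation_mem ω V κ x), sub_self]) hy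
  rw [sub_mul, map_sub, sub_eq_zero] at h
  exact h.symm

theorem expectation_mul_expectation {x y : K →L[ℂ] K} (hy : y ∈ harmonic ω V) :
    expectation ω V κ (y * expectation ω V κ x) = expectation ω V κ (y * x) := by
  have hE := isUCPLike_expectation ω V κ
  have h := congrArg star (expectation_expectation_mul ω V κ (x := star x)
    (star_mem_harmonic ω V hy))
  simpa [← hE.map_star] using h

/-- If the closed unit ball of `Y` is compact for the topology of pointwise convergence on a normed
space `X` on which `Y` is norming, then `Y` is the dual of `X`. -/
theorem surjective_of_compact_ball {Y X : Type*} [NormedAddCommGroup Y] [NormedSpace ℂ Y]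
    [NormedAddCommGroup X] [NormedSpace ℂ X] (ev : Y →ₗ[ℂ] StrongDual ℂ X)
    (hnorm : ∀ f : X, ∀ u : ℝ, (∀ y, ‖y‖ ≤ 1 → ‖ev y f‖ ≤ u) → ‖f‖ ≤ u)
    (hball : ∀ U : Ultrafilter Y, Metric.closedBall 0 1 ∈ U → ∃ y ∈ Metric.closedBall (0 : Y) 1,
      ∀ f, Tendsto (fun z => ev z f) U (𝓝 (ev y f))) : Function.Surjective ev := by
  let g : Y → WeakDual ℂ X := fun y => StrongDual.toWeakDual (ev y)
  have hg : ∀ y f, g y f = ev y f := fun y f => rfl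
  let C : Set (WeakDual ℂ X) := g '' Metric.closedBall 0 1
  have hcomp : IsCompact C := by
    rw [isCompact_iff_ultrafilter_le_nhds]
    intro 𝒱 h𝒱
    have h𝒱' : C ∈ 𝒱 := le_principal_iff.1 h𝒱
    obtain ⟨y, hy, hlim⟩ := hball (Ultrafilter.ofComapInfPrincipal h𝒱')
      (Ultrafilter.ofComapInfPrincipal_mem h𝒱')
    refine ⟨g y, ⟨y, hy, rfl⟩, ?_⟩
    rw [← Ultrafilter.ofComapInfPrincipal_eq_of_map h𝒱']
    change Tendsto g _ _
    exact (WeakBilin.tendsto_iff_forall_eval_tendsto _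
      (ContinuousLinearMap.coe_injective)).2 hlim
  have hmain : ∀ F : StrongDual ℂ X, ‖F‖ ≤ 1 → ∃ y, ev y = F := by
    intro F hF
    by_contra hne
    have hnot : StrongDual.toWeakDual F ∉ C := by
      rintro ⟨y, -, hy⟩
      exact hne ⟨y, StrongDual.toWeakDual.injective hy⟩
    have h1 : IsScalarTower ℝ ℂ (WeakDual ℂ X) :=
      ⟨fun r c f => by
        change ((r • c) • f) = ((r : ℂ) • (c • f))
        rw [smul_smul, Complex.real_smul]⟩
    have h2 : @LocallyConvexSpace ℝ (WeakDual ℂ X) _ _ AddCommGroup.toAddCommMonoid _ _ :=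
      WeakBilin.locallyConvexSpace
    have hconv : Convex ℝ C := by
      rintro _ ⟨a, ha, rfl⟩ _ ⟨b, hb, rfl⟩ s t hs ht hst
      refine ⟨(s : ℂ) • a + (t : ℂ) • b, ?_, ?_⟩
      · rw [mem_closedBall_zero_iff] at *
        refine (norm_add_le _ _).trans ?_
        rw [norm_smul, norm_smul, Complex.norm_real, Complex.norm_real,
          Real.norm_of_nonneg hs, Real.norm_of_nonneg ht]
        nlinarith
      · simp only [g, map_add, map_smul]
        rfl
    obtain ⟨φ, u, hu, huF⟩ := @RCLike.geometric_hahn_banach_closed_point ℂ (WeakDual ℂ X) _ _ _ C _ _ _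
      h1 _ _ h2 hconv hcomp.isClosed hnot
    obtain ⟨f, hf⟩ := LinearMap.dualEmbedding_surjective (topDualPairing ℂ X) φ
    have hφ : ∀ G : WeakDual ℂ X, φ G = G f := fun G => by rw [← hf]; rfl
    simp only [hφ] at hu huF
    have hfu : ‖f‖ ≤ u := by
      refine hnorm f u fun y hy => ?_
      set z := ev y f with hz
      rcases eq_or_ne z 0 with h0 | h0
      · rw [h0, norm_zero]
        have := hu (g 0) ⟨0, by simp, rfl⟩
        rw [hg, map_zero] at this
        simpa using this.le
      · let c : ℂ := starRingEnd ℂ z / ‖z‖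
        have hc : ‖c‖ = 1 := by
          have : ‖z‖ ≠ 0 := norm_ne_zero_iff.2 h0
          simp [c, this]
        have hcz : c * z = ‖z‖ := by
          have : (‖z‖ : ℂ) ≠ 0 := by exact_mod_cast norm_ne_zero_iff.2 h0
          simp only [c]
          rw [div_mul_eq_mul_div, Complex.conj_mul']
          field_simp
        have h1 := hu (g (c • y)) ⟨c • y, by
          rw [mem_closedBall_zero_iff, norm_smul, hc, one_mul]; exact hy, rfl⟩
        rw [hg, map_smul, smul_apply, smul_eq_mul, ← hz, hcz] at h1
        simpa using h1.le
    have h1 : RCLike.re (F f) ≤ ‖f‖ := by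
      refine (RCLike.re_le_norm _).trans ((F.le_opNorm f).trans ?_)
      exact mul_le_of_le_one_left (norm_nonneg _) hF
    have h2 : u < RCLike.re (F f) := huF
    linarith
  intro F
  obtain ⟨y, hy⟩ := hmain (((‖F‖ + 1 : ℝ) : ℂ)⁻¹ • F) (by
    rw [norm_smul, norm_inv, Complex.norm_real, Real.norm_of_nonneg (by positivity)]
    rw [inv_mul_le_iff₀ (by positivity)]
    linarith)
  refine ⟨((‖F‖ + 1 : ℝ) : ℂ) • y, ?_⟩
  have : ((‖F‖ + 1 : ℝ) : ℂ) ≠ 0 := by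
    exact_mod_cast (by positivity : (‖F‖ + 1 : ℝ) ≠ 0)
  rw [map_smul, hy, smul_smul, mul_inv_cancel₀ this, one_smul]

/-- The noncommutative Poisson boundary `H^∞(B(K), P)` of `P(x) = ∑ ω_i V_i^* x V_i`: the space of
`P`-harmonic operators, with the Choi–Effros multiplication `x ∘ y = E(xy)` and the linear
structure, involution, unit and norm of `B(K)`. -/
def PoissonBoundary (_κ : FreeUltrafilter) : Type u := harmonic ω V

namespace PoissonBoundary

/-- The inclusion of the boundary into `B(K)`. -/
def toCLM (x : PoissonBoundary ω V κ) : K →L[ℂ] K := x.1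

instance : NormedAddCommGroup (PoissonBoundary ω V κ) :=
  inferInstanceAs (NormedAddCommGroup (harmonic ω V))

instance : NormedSpace ℂ (PoissonBoundary ω V κ) :=
  inferInstanceAs (NormedSpace ℂ (harmonic ω V))

instance : CompleteSpace (PoissonBoundary ω V κ) :=
  (isClosed_harmonic ω V).completeSpace_coe

variable {ω V κ}

theorem toCLM_mem (x : PoissonBoundary ω V κ) : toCLM ω V κ x ∈ harmonic ω V := x.2

theorem toCLM_injective : Function.Injective (toCLM ω V κ) := Subtype.val_injective

/-- The Choi–Effros product `x ∘ y = E(xy)`. -/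
instance : Mul (PoissonBoundary ω V κ) where
  mul x y := ⟨expectation ω V κ (toCLM ω V κ x * toCLM ω V κ y), expectation_mem ω V κ _⟩

instance : One (PoissonBoundary ω V κ) where
  one := ⟨1, one_mem_harmonic ω V⟩

instance : Star (PoissonBoundary ω V κ) where
  star x := ⟨star (toCLM ω V κ x), star_mem_harmonic ω V x.2⟩

theorem toCLM_mul (x y : PoissonBoundary ω V κ) :
    toCLM ω V κ (x * y) = expectation ω V κ (toCLM ω V κ x * toCLM ω V κ y) := rfl

theorem toCLM_one : toCLM ω V κ 1 = 1 := rfl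

theorem toCLM_star (x : PoissonBoundary ω V κ) : toCLM ω V κ (star x) = star (toCLM ω V κ x) :=
  rfl

theorem toCLM_add (x y : PoissonBoundary ω V κ) :
    toCLM ω V κ (x + y) = toCLM ω V κ x + toCLM ω V κ y := rfl

theorem toCLM_zero : toCLM ω V κ 0 = 0 := rfl

theorem toCLM_smul (c : ℂ) (x : PoissonBoundary ω V κ) :
    toCLM ω V κ (c • x) = c • toCLM ω V κ x := rfl

theorem norm_toCLM (x : PoissonBoundary ω V κ) : ‖toCLM ω V κ x‖ = ‖x‖ := rfl

instance : Ring (PoissonBoundary ω V κ) where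
  __ := (inferInstance : NormedAddCommGroup (PoissonBoundary ω V κ))
  mul := (· * ·)
  one := 1
  left_distrib x y z := toCLM_injective (by
    simp only [toCLM_mul, toCLM_add, mul_add, map_add])
  right_distrib x y z := toCLM_injective (by
    simp only [toCLM_mul, toCLM_add, add_mul, map_add])
  zero_mul x := toCLM_injective (by simp only [toCLM_mul, toCLM_zero, zero_mul, map_zero])
  mul_zero x := toCLM_injective (by simp only [toCLM_mul, toCLM_zero, mul_zero, map_zero])
  mul_assoc x y z := toCLM_injective (by
    simp only [toCLM_mul]
    rw [expectation_expectation_mul ω V κ z.toCLM_mem,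
      expectation_mul_expectation ω V κ x.toCLM_mem, mul_assoc])
  one_mul x := toCLM_injective (by
    rw [toCLM_mul, toCLM_one, one_mul, expectation_of_mem ω V κ x.toCLM_mem])
  mul_one x := toCLM_injective (by
    rw [toCLM_mul, toCLM_one, mul_one, expectation_of_mem ω V κ x.toCLM_mem])

instance : StarRing (PoissonBoundary ω V κ) where
  star_involutive x := toCLM_injective (star_star (toCLM ω V κ x))
  star_mul x y := toCLM_injective (by
    simp only [toCLM_mul, toCLM_star, ← (isUCPLike_expectation ω V κ).map_star, star_mul])
  star_add x y := toCLM_injective (star_add (toCLM ω V κ x) (toCLM ω V κ y))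

instance : NormedRing (PoissonBoundary ω V κ) where
  __ := (inferInstance : NormedAddCommGroup (PoissonBoundary ω V κ))
  __ := (inferInstance : Ring (PoissonBoundary ω V κ))
  norm_mul_le x y := ((isUCPLike_expectation ω V κ).norm_le _).trans
    (norm_mul_le (toCLM ω V κ x) (toCLM ω V κ y))

theorem norm_mul_self_le (x : PoissonBoundary ω V κ) : ‖x‖ * ‖x‖ ≤ ‖star x * x‖ := by
  have h : ‖toCLM ω V κ x‖ ≤ Real.sqrt ‖toCLM ω V κ (star x * x)‖ := by
    refine ContinuousLinearMap.opNorm_le_bound _ (Real.sqrt_nonneg _) fun ξ => ?_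
    have h1 := (isUCPLike_expectation ω V κ).schwarz (toCLM ω V κ x) ξ (toCLM ω V κ x ξ)
    rw [expectation_of_mem ω V κ x.toCLM_mem, inner_self_eq_norm_sq, ← toCLM_star,
      ← toCLM_mul] at h1
    have h2 : RCLike.re (inner ℂ ξ (toCLM ω V κ (star x * x) ξ))
        ≤ ‖toCLM ω V κ (star x * x)‖ * ‖ξ‖ ^ 2 := by
      refine (re_inner_le_norm _ _).trans ?_
      have := (toCLM ω V κ (star x * x)).le_opNorm ξ
      nlinarith [norm_nonneg ξ]
    rw [← Real.sqrt_sq (norm_nonneg ξ), ← Real.sqrt_mul (norm_nonneg _)]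
    exact Real.le_sqrt_of_sq_le (by linarith)
  have h2 := mul_self_le_mul_self (norm_nonneg _) h
  rw [Real.mul_self_sqrt (norm_nonneg _)] at h2
  exact h2

instance : CStarAlgebra (PoissonBoundary ω V κ) where
  __ := (inferInstance : NormedRing (PoissonBoundary ω V κ))
  __ := (inferInstance : StarRing (PoissonBoundary ω V κ))
  __ := (inferInstance : NormedSpace ℂ (PoissonBoundary ω V κ))
  __ := (inferInstance : CompleteSpace (PoissonBoundary ω V κ))
  norm_mul_self_le := norm_mul_self_le
  algebraMap :=
    { toFun c := c • 1
      map_one' := one_smul _ _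
      map_mul' a b := toCLM_injective (by
        simp only [toCLM_mul, toCLM_smul, toCLM_one, smul_mul_smul_comm, mul_one, map_smul,
          (isUCPLike_expectation ω V κ).map_one])
      map_zero' := zero_smul _ _
      map_add' a b := add_smul _ _ _ }
  commutes' c x := toCLM_injective (by
    change toCLM ω V κ ((c • 1) * x) = toCLM ω V κ (x * (c • 1))
    simp only [toCLM_mul, toCLM_smul, toCLM_one, smul_mul_assoc, mul_smul_comm, mul_one, one_mul])
  smul_def' c x := toCLM_injective (by
    change toCLM ω V κ (c • x) = toCLM ω V κ ((c • 1) * x)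
    simp only [toCLM_mul, toCLM_smul, toCLM_one, smul_mul_assoc, one_mul, map_smul,
      expectation_of_mem ω V κ x.toCLM_mem])
  star_smul c x := toCLM_injective (star_smul c (toCLM ω V κ x))

/-- The order of the C*-algebra: `x ≤ y` iff `y - x = z^* ∘ z` for some `z`. -/
instance : PartialOrder (PoissonBoundary ω V κ) := CStarAlgebra.spectralOrder _

instance : StarOrderedRing (PoissonBoundary ω V κ) := CStarAlgebra.spectralOrderedRing _

/-- The functionals on the boundary that are continuous for the weak operator topology on the unit
ball; this is the predual of the boundary. -/
def predual : Submodule ℂ (StrongDual ℂ (PoissonBoundary ω V κ)) where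
  carrier := {f | ∀ (U : Ultrafilter (PoissonBoundary ω V κ)) (y : PoissonBoundary ω V κ),
    Metric.closedBall 0 1 ∈ U → IsWeakLimit (U : Filter _) (toCLM ω V κ) (toCLM ω V κ y) →
    Tendsto f U (𝓝 (f y))}
  add_mem' hf hg U y hU hy := (hf U y hU hy).add (hg U y hU hy)
  zero_mem' _ _ _ _ := tendsto_const_nhds
  smul_mem' c _ hf U y hU hy := (hf U y hU hy).const_smul c

theorem exists_limit (U : Ultrafilter (PoissonBoundary ω V κ))
    (hU : Metric.closedBall 0 1 ∈ U) : ∃ y ∈ Metric.closedBall (0 : PoissonBoundary ω V κ) 1,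
    IsWeakLimit (U : Filter _) (toCLM ω V κ) (toCLM ω V κ y) := by
  have hb : ∀ᶠ x in (U : Filter (PoissonBoundary ω V κ)), ‖toCLM ω V κ x‖ ≤ 1 := by
    filter_upwards [hU] with x hx
    simpa [norm_toCLM] using hx
  obtain ⟨T, hT⟩ := exists_isWeakLimit U (toCLM ω V κ) 1 hb
  refine ⟨⟨T, hT.mem_harmonic ω V 1 hb fun x => x.toCLM_mem⟩, ?_, hT⟩
  refine mem_closedBall_zero_iff.2 ?_
  exact hT.norm_le zero_le_one hb

theorem isClosed_predual :
    IsClosed (predual : Submodule ℂ (StrongDual ℂ (PoissonBoundary ω V κ))).carrier := by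
  rw [← isSeqClosed_iff_isClosed]
  intro f g hf hg U y hU hy
  rw [Metric.tendsto_nhds]
  intro ε hε
  have h1 := (Metric.tendsto_nhds.1 hg (ε / 3) (by positivity)).exists
  obtain ⟨n, hn⟩ := h1
  rw [dist_eq_norm] at hn
  have hy1 : ‖y‖ ≤ 1 := hy.norm_le zero_le_one (by
    filter_upwards [hU] with x hx
    simpa [norm_toCLM] using hx)
  have h2 := Metric.tendsto_nhds.1 (hf n U y hU hy) (ε / 3) (by positivity)
  filter_upwards [hU, h2] with x hx hx2
  rw [mem_closedBall_zero_iff] at hx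
  have key : ∀ z : PoissonBoundary ω V κ, ‖z‖ ≤ 1 → ‖f n z - g z‖ < ε / 3 := fun z hz =>
    lt_of_le_of_lt (by
      have := (f n - g).le_opNorm z
      rw [sub_apply] at this
      refine this.trans (mul_le_of_le_one_right (norm_nonneg _) hz)) hn
  rw [dist_eq_norm] at hx2 ⊢
  have e : g x - g y = -(f n x - g x) + (f n x - f n y) + (f n y - g y) := by ring
  rw [e]
  have h3 := key x hx
  have h4 := key y hy1
  calc _ ≤ ‖f n x - g x‖ + ‖f n x - f n y‖ + ‖f n y - g y‖ := by
        refine (norm_add_le _ _).trans ?_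
        gcongr
        refine (norm_add_le _ _).trans ?_
        rw [norm_neg]
    _ < ε := by linarith

/-- The functional `x ↦ ⟨xξ, η⟩`. -/
def vectorFunctional (ξ η : K) : StrongDual ℂ (PoissonBoundary ω V κ) :=
  LinearMap.mkContinuous
    { toFun x := inner ℂ η (toCLM ω V κ x ξ)
      map_add' x y := by simp [toCLM_add]
      map_smul' c x := by simp [toCLM_smul] }
    (‖η‖ * ‖ξ‖) fun x => by
      refine (norm_inner_le_norm _ _).trans ?_
      have := (toCLM ω V κ x).le_opNorm ξ
      rw [norm_toCLM] at this
      calc _ ≤ ‖η‖ * (‖x‖ * ‖ξ‖) := by gcongr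
        _ = _ := by ring

theorem vectorFunctional_mem (ξ η : K) :
    (vectorFunctional ξ η : StrongDual ℂ (PoissonBoundary ω V κ)) ∈ predual :=
  fun _ _ _ hy => hy ξ η

theorem norm_vectorFunctional_le (ξ η : K) :
    ‖(vectorFunctional ξ η : StrongDual ℂ (PoissonBoundary ω V κ))‖ ≤ ‖η‖ * ‖ξ‖ :=
  LinearMap.mkContinuous_norm_le _ (by positivity) _

variable (ω V κ) in
/-- The predual as a normed space. -/
def Predual : Type u := (predual : Submodule ℂ (StrongDual ℂ (PoissonBoundary ω V κ)))

instance : NormedAddCommGroup (Predual ω V κ) :=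
  inferInstanceAs (NormedAddCommGroup
    (predual : Submodule ℂ (StrongDual ℂ (PoissonBoundary ω V κ))))

instance : NormedSpace ℂ (Predual ω V κ) :=
  inferInstanceAs (NormedSpace ℂ
    (predual : Submodule ℂ (StrongDual ℂ (PoissonBoundary ω V κ))))

instance : CompleteSpace (Predual ω V κ) := isClosed_predual.completeSpace_coe

/-- The functional underlying an element of the predual. -/
def Predual.toFunctional (f : Predual ω V κ) : StrongDual ℂ (PoissonBoundary ω V κ) := f.1

theorem Predual.norm_toFunctional (f : Predual ω V κ) : ‖f.toFunctional‖ = ‖f‖ := rfl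

/-- The evaluation map from the boundary to the dual of its predual. -/
def evalPredual : PoissonBoundary ω V κ →ₗ[ℂ] StrongDual ℂ (Predual ω V κ) where
  toFun y := LinearMap.mkContinuous
    { toFun f := f.toFunctional y
      map_add' _ _ := rfl
      map_smul' _ _ := rfl } ‖y‖ fun f => by
        rw [mul_comm]
        exact f.toFunctional.le_opNorm y
  map_add' y z := by
    ext f
    exact map_add f.toFunctional y z
  map_smul' c y := by
    ext f
    exact map_smul f.toFunctional c y

theorem evalPredual_apply (y : PoissonBoundary ω V κ) (f : Predual ω V κ) :
    evalPredual y f = f.toFunctional y := rfl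

theorem norm_evalPredual (y : PoissonBoundary ω V κ) : ‖evalPredual y‖ = ‖y‖ := by
  refine le_antisymm ?_ ?_
  · refine ContinuousLinearMap.opNorm_le_bound _ (norm_nonneg _) fun f => ?_
    rw [evalPredual_apply, mul_comm]
    exact f.toFunctional.le_opNorm y
  · rw [← norm_toCLM]
    refine ContinuousLinearMap.opNorm_le_of_re_inner_le (norm_nonneg _) fun ξ η hξ hη => ?_
    rw [inner_re_symm]
    let v : Predual ω V κ := ⟨vectorFunctional ξ η, vectorFunctional_mem ξ η⟩
    have h : ‖inner ℂ η (toCLM ω V κ y ξ)‖ ≤ ‖evalPredual y‖ * ‖v‖ := (evalPredual y).le_opNorm v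
    have h2 : ‖v‖ ≤ 1 := by
      have := norm_vectorFunctional_le (ω := ω) (V := V) (κ := κ) ξ η
      rwa [hξ, hη, mul_one] at this
    calc RCLike.re (inner ℂ η (toCLM ω V κ y ξ)) ≤ ‖inner ℂ η (toCLM ω V κ y ξ)‖ :=
          RCLike.re_le_norm _
      _ ≤ _ := h
      _ ≤ ‖evalPredual y‖ := mul_le_of_le_one_right (norm_nonneg _) h2

theorem evalPredual_surjective : Function.Surjective
    (evalPredual : PoissonBoundary ω V κ →ₗ[ℂ] StrongDual ℂ (Predual ω V κ)) := by
  refine surjective_of_compact_ball _ (fun f u h => ?_) fun U hU => ?_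
  · have h0 : 0 ≤ u := by simpa using h 0 (by simp)
    rw [← Predual.norm_toFunctional]
    refine ContinuousLinearMap.opNorm_le_of_unit_norm h0 fun y hy => ?_
    exact h y hy.le
  · obtain ⟨y, hy, hlim⟩ := exists_limit U hU
    exact ⟨y, hy, fun f => f.2 U y hU hlim⟩

/-- The boundary is a von Neumann algebra: a C*-algebra with a predual. -/
instance : WStarAlgebra (PoissonBoundary ω V κ) where
  exists_predual := by
    let e : PoissonBoundary ω V κ ≃ₗᵢ[ℂ] StrongDual ℂ (Predual ω V κ) :=
      LinearIsometryEquiv.ofSurjective ⟨evalPredual, norm_evalPredual⟩ evalPredual_surjective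
    exact ⟨Predual ω V κ, inferInstance, inferInstance, inferInstance,
      ⟨e.symm.trans (starₗᵢ ℂ)⟩⟩

end PoissonBoundary

end Markov
end Boundary

section Fock

/-- A bundled complex Hilbert space. -/
structure HilbertSpc where
  /-- The underlying type. -/
  carrier : Type u
  [normedAddCommGroup : NormedAddCommGroup carrier]
  [innerProductSpace : InnerProductSpace ℂ carrier]
  [completeSpace : CompleteSpace carrier]

/-- The scalars `ℂ` with the inner product `⟨z, w⟩ = conj(z) w`, in an arbitrary universe. -/
instance scalarInnerProductSpace : InnerProductSpace ℂ (ULift.{u} ℂ) where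
  inner z w := inner ℂ z.down w.down
  norm_sq_eq_re_inner z := norm_sq_eq_re_inner z.down
  conj_inner_symm z w := inner_conj_symm z.down w.down
  add_left z w v := inner_add_left z.down w.down v.down
  smul_left z w c := inner_smul_left z.down w.down c

variable (H : Type u) [NormedAddCommGroup H] [InnerProductSpace ℂ H]

/-- The Hilbert tensor powers of `H`, as bundled Hilbert spaces: `H^{⊗0} = ℂ` and `H^{⊗(n+1)}` is
the completion of the algebraic tensor product `H ⊗ H^{⊗n}` with its inner product
`⟨ξ ⊗ s, η ⊗ t⟩ = ⟨ξ, η⟩ ⟨s, t⟩`. -/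
def tensorPowerSpc : ℕ → HilbertSpc.{u}
  | 0 => ⟨ULift.{u} ℂ⟩
  | n + 1 =>
    letI := (tensorPowerSpc n).normedAddCommGroup
    letI := (tensorPowerSpc n).innerProductSpace
    ⟨UniformSpace.Completion (H ⊗[ℂ] (tensorPowerSpc n).carrier)⟩

/-- The Hilbert tensor power `H^{⊗n}`. -/
def TensorPower (n : ℕ) : Type u := (tensorPowerSpc H n).carrier

instance (n : ℕ) : NormedAddCommGroup (TensorPower H n) := (tensorPowerSpc H n).normedAddCommGroup

instance (n : ℕ) : InnerProductSpace ℂ (TensorPower H n) := (tensorPowerSpc H n).innerProductSpace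

instance (n : ℕ) : CompleteSpace (TensorPower H n) := (tensorPowerSpc H n).completeSpace

/-- The full Fock space `⊕_{n ≥ 0} H^{⊗n}` (Hilbert space direct sum). -/
abbrev FockSpace : Type u := lp (TensorPower H) 2

/-- A complex number as an element of `H^{⊗0} = ℂ`. -/
def scalar (z : ℂ) : TensorPower H 0 := (ULift.up z : ULift.{u} ℂ)

theorem norm_scalar (z : ℂ) : ‖scalar H z‖ = ‖z‖ := rfl

/-- The vacuum vector of the Fock space, given by a complex number `Ω` in `H^{⊗0}`. -/
def vacuum (Ω : ℂ) : FockSpace H := lp.single 2 0 (scalar H Ω)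

theorem norm_vacuum (Ω : ℂ) : ‖vacuum H Ω‖ = ‖Ω‖ := by
  rw [vacuum, lp.norm_single (by norm_num), norm_scalar]

variable {H}

/-- The elementary tensor `ξ ⊗ t ∈ H^{⊗(n+1)}` of `ξ ∈ H` and `t ∈ H^{⊗n}`. -/
def tensorCons {n : ℕ} (ξ : H) (t : TensorPower H n) : TensorPower H (n + 1) :=
  ((ξ ⊗ₜ[ℂ] t : H ⊗[ℂ] TensorPower H n) : UniformSpace.Completion (H ⊗[ℂ] TensorPower H n))

theorem tensorCons_add {n : ℕ} (ξ : H) (s t : TensorPower H n) :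
    tensorCons ξ (s + t) = tensorCons ξ s + tensorCons ξ t := by
  rw [tensorCons, TensorProduct.tmul_add, UniformSpace.Completion.coe_add]
  rfl

theorem tensorCons_smul {n : ℕ} (ξ : H) (c : ℂ) (t : TensorPower H n) :
    tensorCons ξ (c • t) = c • tensorCons ξ t := by
  rw [tensorCons, TensorProduct.tmul_smul, UniformSpace.Completion.coe_smul]
  rfl

theorem norm_tensorCons {n : ℕ} (ξ : H) (t : TensorPower H n) :
    ‖tensorCons ξ t‖ = ‖ξ‖ * ‖t‖ :=
  (UniformSpace.Completion.norm_coe (ξ ⊗ₜ[ℂ] t : H ⊗[ℂ] TensorPower H n)).trans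
    (TensorProduct.norm_tmul ξ t)

theorem inner_tensorCons {n : ℕ} (ξ η : H) (s t : TensorPower H n) :
    inner ℂ (tensorCons ξ s) (tensorCons η t) = inner ℂ ξ η * inner ℂ s t :=
  (UniformSpace.Completion.inner_coe (ξ ⊗ₜ[ℂ] s : H ⊗[ℂ] TensorPower H n) (η ⊗ₜ[ℂ] t)).trans
    (by rw [TensorProduct.inner_tmul])

/-- The components of `ξ ⊗ f` for `f` in the Fock space. -/
def consFun (ξ : H) (f : ∀ n, TensorPower H n) : ∀ n, TensorPower H n
  | 0 => 0
  | n + 1 => tensorCons ξ (f n)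

theorem hasSum_consFun (ξ : H) (f : FockSpace H) :
    HasSum (fun n => ‖consFun ξ f n‖ ^ (2 : ℝ)) ((‖ξ‖ * ‖f‖) ^ (2 : ℝ)) := by
  have h := (lp.hasSum_norm (p := 2) (by norm_num) f).mul_left (‖ξ‖ ^ (2 : ℝ))
  rw [show ((2 : ENNReal).toReal) = (2 : ℝ) by norm_num,
    ← Real.mul_rpow (norm_nonneg _) (norm_nonneg _)] at h
  rw [← hasSum_nat_add_iff' 1]
  simpa [consFun, norm_tensorCons, mul_pow] using h

theorem memℓp_consFun (ξ : H) (f : FockSpace H) : Memℓp (consFun ξ f) 2 :=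
  memℓp_gen (by simpa using (hasSum_consFun ξ f).summable)

/-- The left creation operator `l_ξ`, `l_ξ(f) = ξ ⊗ f`, on the Fock space as a linear map. -/
def leftCreationₗ (ξ : H) : FockSpace H →ₗ[ℂ] FockSpace H where
  toFun f := ⟨consFun ξ f, memℓp_consFun ξ f⟩
  map_add' f g := by
    ext n
    cases n with
    | zero => exact (add_zero (0 : TensorPower H 0)).symm
    | succ n => exact tensorCons_add ξ (f n) (g n)
  map_smul' c f := by
    ext n
    cases n with
    | zero => exact (smul_zero c : c • (0 : TensorPower H 0) = 0).symm
    | succ n => exact tensorCons_smul ξ c (f n)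

theorem norm_leftCreationₗ (ξ : H) (f : FockSpace H) : ‖leftCreationₗ ξ f‖ = ‖ξ‖ * ‖f‖ := by
  have h1 := lp.hasSum_norm (p := 2) (by norm_num) (leftCreationₗ ξ f)
  rw [show ((2 : ENNReal).toReal) = (2 : ℝ) by norm_num] at h1
  have h2 := h1.unique (hasSum_consFun ξ f)
  simpa using (sq_eq_sq₀ (norm_nonneg _) (by positivity)).1 (by simpa using h2)

/-- The left creation operator `l_ξ` on the Fock space. -/
def leftCreation (ξ : H) : FockSpace H →L[ℂ] FockSpace H :=
  (leftCreationₗ ξ).mkContinuous ‖ξ‖ fun f => (norm_leftCreationₗ ξ f).le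

variable {Θ : Type*} (e : HilbertBasis Θ ℂ H)

/-- The left creation operator `l_i = l_{e_i}` of a basis vector, which is an isometry. -/
def basisCreation (i : Θ) : FockSpace H →ₗᵢ[ℂ] FockSpace H where
  toLinearMap := (leftCreation (e i)).toLinearMap
  norm_map' f := (norm_leftCreationₗ (e i) f).trans (by
    rw [e.orthonormal.1 i, one_mul])

variable (ω : Weights Θ) (κ : FreeUltrafilter)

/-- `H^∞ = H^∞(B(F(H)), P_ω)` for the map `P_ω(x) = ∑ ω_i l_i^* x l_i`. -/
abbrev HInfty : Type u := PoissonBoundary ω (basisCreation e) κ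

/-- The restriction of the vector state `x ↦ ⟨xΩ, Ω⟩` to `H^∞`. (Mathlib's inner product is
linear in its second argument.) -/
def vacuumState (Ω : ℂ) : HInfty e ω κ →ₗ[ℂ] ℂ where
  toFun x := inner ℂ (vacuum H Ω) (PoissonBoundary.toCLM ω (basisCreation e) κ x (vacuum H Ω))
  map_add' x y := by simp [PoissonBoundary.toCLM_add]
  map_smul' c x := by simp [PoissonBoundary.toCLM_smul]

end Fock

/-- A linear functional `φ` on a von Neumann algebra `M` is a faithful normal state: it is
positive, unital, vanishes at no nonzero positive element, and preserves the least upper bounds of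
upward directed families of self-adjoint elements. -/
structure IsFaithfulNormalState {M : Type*} [CStarAlgebra M] [WStarAlgebra M] [PartialOrder M]
    [StarOrderedRing M] (φ : M →ₗ[ℂ] ℂ) : Prop where
  nonneg : ∀ x : M, 0 ≤ x → 0 ≤ φ x
  map_one : φ 1 = 1
  faithful : ∀ x : M, 0 ≤ x → φ x = 0 → x = 0
  normal : ∀ (D : Set M) (s : M), D.Nonempty → (∀ x ∈ D, IsSelfAdjoint x) →
    DirectedOn (· ≤ ·) D → IsLUB D s → IsLUB (φ '' D) (φ s)

end Poisson

end

noncomputable section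

namespace Poisson

universe v

/-! The product of $H^\infty$ is not that of $B(\mathcal F(\mathcal H))$, so its positive cone,
defined through squares $z^*\circ z$, has first to be identified. For a self-adjoint element of a
unital C*-algebra, positivity depends only on the norm and the unit
(`nonneg_iff_norm_smul_one_sub_le`), and both algebras share norm, unit, involution and linear
structure. Hence the order of $H^\infty$ is the operator order (`toCLM_nonneg_iff`), and positivity
of $\varphi$ is that of a vector state.

Normality rests on compactness. Along an ultrafilter that refines an upward directed set $D$, the
operators have a weak operator limit, which is again harmonic because $P_\omega$ respects weak
limits of bounded families. The limit lies above $D$ and below $\sup D$, so it is $\sup D$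
(`exists_ultrafilter_isWeakLimit`); vector states are weakly continuous, so they preserve the
supremum.

Faithfulness combines harmonicity with cyclicity of the vacuum. Let $x \ge 0$ be harmonic with
$\langle x\Omega,\Omega\rangle = 0$; then $x\Omega = 0$. If $x\xi = 0$, then $0 = \langle
P_\omega(x)\xi,\xi\rangle = \sum_i \omega_i\langle x l_i\xi, l_i\xi\rangle$ has nonnegative terms
with $\omega_i > 0$, so $x l_i\xi = 0$ for every $i$ (`apply_isometry_eq_zero`). The kernel of $x$
is thus a closed subspace that contains $\Omega$ and is invariant under all $l_i$. Such a subspace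
is the whole Fock space (`eq_top_of_vacuum_mem`), whence $x = 0$. -/

/-- An element of a unital C*-algebra is positive if and only if it is self-adjoint and lies in the
closed ball of radius `‖a‖` about `‖a‖ • 1`. -/
theorem nonneg_iff_norm_smul_one_sub_le {A : Type*} [CStarAlgebra A] [PartialOrder A]
    [StarOrderedRing A] {a : A} :
    0 ≤ a ↔ IsSelfAdjoint a ∧ ‖((‖a‖ : ℝ) : ℂ) • (1 : A) - a‖ ≤ ‖a‖ := by
  rw [nonneg_iff_isSelfAdjoint_and_quasispectrumRestricts]
  refine and_congr_right fun ha => ?_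
  -- For self-adjoint $a$, the bound $\|t - a\| \le t$ with $t \ge \|a\|$ says exactly that the
  -- spectrum of $a$ is nonnegative; here $t = \|a\|$.
  rw [quasispectrumRestricts_iff_spectrumRestricts,
    SpectrumRestricts.nnreal_iff_nnnorm ha (le_refl ‖a‖₊), ← NNReal.coe_le_coe, coe_nnnorm,
    coe_nnnorm, Algebra.algebraMap_eq_smul_one, Complex.coe_smul]

/-! ### Positive operators, weak limits and kernels of harmonic operators. -/

section Boundary

variable {K : Type v} [NormedAddCommGroup K] [InnerProductSpace ℂ K] [CompleteSpace K]

/-- Writing $x = z^*z$ turns the hypothesis into $\|z\xi\|^2 = 0$, and then $x\xi = z^*(z\xi) = 0$.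
-/
theorem apply_eq_zero_of_nonneg {x : K →L[ℂ] K} (hx : 0 ≤ x) {ξ : K}
    (h : inner ℂ ξ (x ξ) = 0) : x ξ = 0 := by
  obtain ⟨z, rfl⟩ := CStarAlgebra.nonneg_iff_eq_star_mul_self.1 hx
  have hz : z ξ = 0 := by
    simpa [ContinuousLinearMap.star_eq_adjoint, ContinuousLinearMap.adjoint_inner_right] using h
  simp [hz]

theorem inner_apply_nonneg {x : K →L[ℂ] K} (hx : 0 ≤ x) (ξ : K) : 0 ≤ inner ℂ ξ (x ξ) :=
  ((ContinuousLinearMap.nonneg_iff_isPositive _).1 hx).inner_nonneg_right ξ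

/-- Weak operator limits of eventually positive families are positive. -/
theorem IsWeakLimit.nonneg {ι : Type*} {F : Filter ι} [F.NeBot] {a : ι → K →L[ℂ] K}
    {S : K →L[ℂ] K} (hS : IsWeakLimit F a S) (h : ∀ᶠ i in F, 0 ≤ a i) : 0 ≤ S := by
  have hpos : ∀ ξ, 0 ≤ inner ℂ ξ (S ξ) := fun ξ =>
    ge_of_tendsto (hS ξ ξ) (h.mono fun i hi => inner_apply_nonneg hi ξ)
  -- Self-adjointness of the limit: the adjoints converge to `star S` and eventually coincide with
  -- the operators themselves, so uniqueness of weak limits applies.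
  have hstar : IsWeakLimit F a (Star.star S) := fun ξ η =>
    (hS.star ξ η).congr' (h.mono fun i hi =>
      congrArg (fun b : K →L[ℂ] K => inner ℂ η (b ξ)) (IsSelfAdjoint.of_nonneg hi).star_eq)
  rw [ContinuousLinearMap.nonneg_iff_isPositive, ContinuousLinearMap.isPositive_def']
  refine ⟨hstar.unique hS, fun ξ => ?_⟩
  rw [ContinuousLinearMap.reApplyInnerSelf_apply, inner_re_symm]
  exact (RCLike.nonneg_iff.1 (hpos ξ)).1

variable {Θ : Type*} {ω : Weights Θ} {V : Θ → K →ₗᵢ[ℂ] K}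

/-- The kernel of a positive harmonic operator is invariant under the isometries `V_i`. -/
theorem apply_isometry_eq_zero {x : K →L[ℂ] K} (hx : 0 ≤ x) (hP : x ∈ harmonic ω V) {ξ : K}
    (h : x ξ = 0) (i : Θ) : x (V i ξ) = 0 := by
  -- The identity $P(x) = x$ is tested on $\xi$: a series of nonnegative terms has sum $\langle \xi,
  -- x\xi\rangle = 0$, so each term vanishes, and the strictly positive weight can be cancelled.
  have hsum := hasSum_inner_markov ω V x ξ ξ
  rw [(mem_harmonic ω V).1 hP, h, inner_zero_right] at hsum
  have h0 := (hasSum_zero_iff_of_nonneg fun j => mul_nonneg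
    (Complex.zero_le_real.2 (ω.pos j).le) (inner_apply_nonneg hx (V j ξ))).1 hsum
  have hi : (ω.val i : ℂ) * inner ℂ (V i ξ) (x (V i ξ)) = 0 := congrFun h0 i
  exact apply_eq_zero_of_nonneg hx
    ((mul_eq_zero.1 hi).resolve_left (Complex.ofReal_ne_zero.2 (ω.pos i).ne'))

/-! ### Order and directed suprema in the boundary. -/

namespace PoissonBoundary

variable {κ : FreeUltrafilter}

theorem toCLM_sub (x y : PoissonBoundary ω V κ) :
    toCLM ω V κ (x - y) = toCLM ω V κ x - toCLM ω V κ y := rfl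

/-- The order of the boundary is the order of `B(K)`. -/
theorem toCLM_nonneg_iff {x : PoissonBoundary ω V κ} : 0 ≤ toCLM ω V κ x ↔ 0 ≤ x := by
  -- The criterion does not mention the product, the only structure in which the boundary differs
  -- from `K →L[ℂ] K`.
  rw [nonneg_iff_norm_smul_one_sub_le, nonneg_iff_norm_smul_one_sub_le, norm_toCLM,
    ← norm_toCLM (_ - x), toCLM_sub, toCLM_smul, toCLM_one]
  refine and_congr_left fun _ => ?_
  rw [IsSelfAdjoint, IsSelfAdjoint, ← toCLM_injective.eq_iff, toCLM_star]

theorem toCLM_le_iff {x y : PoissonBoundary ω V κ} :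
    toCLM ω V κ x ≤ toCLM ω V κ y ↔ x ≤ y := by
  rw [← sub_nonneg, ← toCLM_sub, toCLM_nonneg_iff, sub_nonneg]

/-- The least upper bound of an upward directed set of self-adjoint elements is a limit in the
weak operator topology along an ultrafilter on that set. -/
theorem exists_ultrafilter_isWeakLimit {D : Set (PoissonBoundary ω V κ)}
    {s : PoissonBoundary ω V κ} (hne : D.Nonempty) (hdir : DirectedOn (· ≤ ·) D)
    (hs : IsLUB D s) :
    ∃ U : Ultrafilter (PoissonBoundary ω V κ), D ∈ U ∧
      IsWeakLimit (U : Filter _) (toCLM ω V κ) (toCLM ω V κ s) := by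
  have : Nonempty D := hne.to_subtype
  have : IsDirectedOrder D := ⟨fun a b => by
    obtain ⟨c, hc, hac, hbc⟩ := hdir a a.2 b b.2
    exact ⟨⟨c, hc⟩, hac, hbc⟩⟩
  -- Since $D$ is directed, its sections $\{x \in D : d \le x\}$ generate a proper filter; any
  -- ultrafilter finer than it eventually lies above each $d \in D$.
  let U := (Ultrafilter.of (atTop : Filter D)).map (Subtype.val : D → PoissonBoundary ω V κ)
  have hge : ∀ d ∈ D, ∀ᶠ x in (U : Filter _), d ≤ x := fun d hd =>
    Ultrafilter.of_le (atTop : Filter D) (eventually_ge_atTop (⟨d, hd⟩ : D))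
  have hD : ∀ᶠ x in (U : Filter _), x ∈ D :=
    Ultrafilter.mem_map.2 (Filter.univ_mem' fun d : D => d.2)
  obtain ⟨d₀, hd₀⟩ := hne
  -- The set $D$ may be unbounded in norm, but its part above a fixed $d_0$ is not: there $0 \le x -
  -- d_0 \le s - d_0$, and the norm is monotone on positive elements.
  let C := ‖s - d₀‖ + ‖d₀‖
  have hb : ∀ᶠ x in (U : Filter _), ‖toCLM ω V κ x‖ ≤ C := by
    filter_upwards [hge d₀ hd₀, hD] with x hx hxD
    have h1 : ‖x - d₀‖ ≤ ‖s - d₀‖ := CStarAlgebra.norm_le_norm_of_nonneg_of_le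
      (sub_nonneg.2 hx) (sub_le_sub_right (hs.1 hxD) d₀)
    calc ‖x‖ = ‖(x - d₀) + d₀‖ := by rw [sub_add_cancel]
      _ ≤ ‖x - d₀‖ + ‖d₀‖ := norm_add_le _ _
      _ ≤ C := add_le_add_left h1 _
  obtain ⟨T, hT⟩ := exists_isWeakLimit U (toCLM ω V κ) C hb
  -- Harmonicity of the limit is essential: $s$ is least only among upper bounds inside the
  -- boundary.
  let t : PoissonBoundary ω V κ := ⟨T, hT.mem_harmonic ω V C hb fun x => x.toCLM_mem⟩
  have ht : IsWeakLimit (U : Filter _) (toCLM ω V κ) (toCLM ω V κ t) := hT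
  have hub : t ∈ upperBounds D := fun d hd => by
    rw [← toCLM_le_iff, ← sub_nonneg]
    have hlim : IsWeakLimit (U : Filter _) (fun x => toCLM ω V κ x - toCLM ω V κ d)
        (toCLM ω V κ t - toCLM ω V κ d) := fun ξ η => by
      simpa [inner_sub_right] using (ht ξ η).sub_const (inner ℂ η (toCLM ω V κ d ξ))
    exact hlim.nonneg ((hge d hd).mono fun x hx => sub_nonneg.2 (toCLM_le_iff.2 hx))
  have hle : t ≤ s := by
    rw [← toCLM_le_iff, ← sub_nonneg]
    have hlim : IsWeakLimit (U : Filter _) (fun x => toCLM ω V κ s - toCLM ω V κ x)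
        (toCLM ω V κ s - toCLM ω V κ t) := fun ξ η => by
      simpa [inner_sub_right] using (ht ξ η).const_sub (inner ℂ η (toCLM ω V κ s ξ))
    exact hlim.nonneg (hD.mono fun x hx => sub_nonneg.2 (toCLM_le_iff.2 (hs.1 hx)))
  rw [hle.antisymm (hs.2 hub)] at ht
  exact ⟨U, hD, ht⟩

/-- Vector states of `B(K)` are normal on the boundary. -/
theorem isLUB_image_vectorFunctional (ξ : K) {D : Set (PoissonBoundary ω V κ)}
    {s : PoissonBoundary ω V κ} (hne : D.Nonempty) (hdir : DirectedOn (· ≤ ·) D)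
    (hs : IsLUB D s) :
    IsLUB ((fun x => inner ℂ ξ (toCLM ω V κ x ξ)) '' D) (inner ℂ ξ (toCLM ω V κ s ξ)) := by
  refine ⟨?_, fun b hb => ?_⟩
  · rintro _ ⟨d, hd, rfl⟩
    have h := inner_apply_nonneg (sub_nonneg.2 (toCLM_le_iff.2 (hs.1 hd))) ξ
    rw [sub_apply, inner_sub_right] at h
    exact sub_nonneg.1 h
  · obtain ⟨U, hU, hlim⟩ := exists_ultrafilter_isWeakLimit hne hdir hs
    -- The value at $s$ is a limit of values at elements of $D$, and the order of $\mathbb C$ is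
    -- closed, so every upper bound of those values bounds the limit.
    exact le_of_tendsto (hlim ξ ξ) (Filter.mem_of_superset hU fun d hd => hb ⟨d, hd, rfl⟩)

end PoissonBoundary
end Boundary

/-! ### Cyclicity of the vacuum for the creation operators. -/

section Fock

variable {H : Type v} [NormedAddCommGroup H] [InnerProductSpace ℂ H]

/-- Creation raises the degree by exactly one. This turns invariance under creation operators into
an induction on the degree. -/
theorem single_tensorCons (ξ : H) {n : ℕ} (t : TensorPower H n) :
    lp.single 2 (n + 1) (tensorCons ξ t) = leftCreation ξ (lp.single 2 n t) := by
  ext m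
  cases m with
  | zero => exact lp.single_apply_ne 2 (n + 1) _ (Nat.succ_ne_zero n).symm
  | succ m =>
    change _ = tensorCons ξ ((lp.single 2 n t : FockSpace H) m)
    rcases eq_or_ne m n with rfl | hmn
    · rw [lp.single_apply_self, lp.single_apply_self]
    · rw [lp.single_apply_ne _ _ _ hmn, lp.single_apply_ne _ _ _ (by simpa using hmn)]
      -- Off degree $n$ the component is $\xi \otimes 0$, which vanishes because the norm is
      -- multiplicative on elementary tensors.
      rw [eq_comm, ← norm_eq_zero, norm_tensorCons, norm_zero, mul_zero]

/-- The map `ξ ↦ ξ ⊗ t` as a continuous linear map. -/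
def tensorConsLeft {n : ℕ} (t : TensorPower H n) : H →L[ℂ] TensorPower H (n + 1) :=
  LinearMap.mkContinuous
    { toFun ξ := tensorCons ξ t
      map_add' ξ η := by
        rw [tensorCons, TensorProduct.add_tmul, UniformSpace.Completion.coe_add]
        rfl
      map_smul' c ξ := by
        rw [tensorCons, ← TensorProduct.smul_tmul', UniformSpace.Completion.coe_smul]
        rfl } ‖t‖ fun ξ => by
      rw [mul_comm]
      exact (norm_tensorCons ξ t).le

/-- A closed subspace of `H^{⊗(n+1)}` that contains the elementary tensors is everything. -/
theorem eq_top_of_tensorCons_mem {n : ℕ} {W : Submodule ℂ (TensorPower H (n + 1))}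
    (hW : IsClosed (W : Set (TensorPower H (n + 1))))
    (h : ∀ (ξ : H) (t : TensorPower H n), tensorCons ξ t ∈ W) : W = ⊤ := by
  rw [Submodule.eq_top_iff']
  intro u
  -- Closedness of $W$ reduces membership to the dense algebraic tensor product, whose elements are
  -- finite sums of elementary tensors.
  refine UniformSpace.Completion.induction_on
    (p := fun u : UniformSpace.Completion (H ⊗[ℂ] TensorPower H n) =>
      (show TensorPower H (n + 1) from u) ∈ W) u hW fun a => ?_
  induction a with
  | zero => exact W.zero_mem
  | tmul ξ t => exact h ξ t
  | add a b ha hb =>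
    rw [UniformSpace.Completion.coe_add]
    exact W.add_mem ha hb

variable {Θ : Type*} (e : HilbertBasis Θ ℂ H)

/-- The vacuum vector is cyclic for the creation operators: a closed subspace of the Fock space that
contains the vacuum and is invariant under the creation operators of an orthonormal basis is
everything. -/
theorem eq_top_of_vacuum_mem {N : Submodule ℂ (FockSpace H)}
    (hN : IsClosed (N : Set (FockSpace H))) {Ω : ℂ} (hΩ : Ω ≠ 0) (hvac : vacuum H Ω ∈ N)
    (hinv : ∀ i, ∀ f ∈ N, basisCreation e i f ∈ N) : N = ⊤ := by
  have key : ∀ (n : ℕ) (t : TensorPower H n), (lp.single 2 n t : FockSpace H) ∈ N := by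
    intro n
    induction n with
    | zero =>
      intro t
      -- Degree zero is one-dimensional, so the nonzero scalar $\Omega$ spans it.
      have ht : t = (t.down / Ω) • scalar H Ω :=
        congrArg ULift.up (div_mul_cancel₀ t.down hΩ).symm
      rw [ht, lp.single_smul]
      exact N.smul_mem _ hvac
    | succ n ih =>
      let W (m : ℕ) : Submodule ℂ (TensorPower H m) :=
        N.comap (lp.singleContinuousLinearMap ℂ (TensorPower H) 2 m).toLinearMap
      have hWc (m : ℕ) : IsClosed (W m : Set (TensorPower H m)) :=
        hN.preimage (lp.singleContinuousLinearMap ℂ (TensorPower H) 2 m).continuous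
      have hW : W (n + 1) = ⊤ := eq_top_of_tensorCons_mem (hWc _) fun ξ t => by
        -- Invariance is available only for the basis vectors. For fixed $t$, the $\xi$ with $\xi
        -- \otimes t$ in the subspace form a closed subspace of $H$; it contains every $e_i$ by the
        -- induction hypothesis, hence all of $H$ by density of their span.
        have hcl : IsClosed ((W (n + 1)).comap (tensorConsLeft t).toLinearMap : Set H) :=
          (hWc _).preimage (tensorConsLeft t).continuous
        have hle : Submodule.span ℂ (Set.range e) ≤
            (W (n + 1)).comap (tensorConsLeft t).toLinearMap := by
          rw [Submodule.span_le]
          rintro _ ⟨i, rfl⟩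
          change lp.single 2 (n + 1) (tensorCons (e i) t) ∈ N
          rw [single_tensorCons]
          exact hinv i _ (ih t)
        have htop := Submodule.topologicalClosure_minimal _ hle hcl
        rw [e.dense_span] at htop
        exact htop (Submodule.mem_top (x := ξ))
      intro t
      have ht : t ∈ W (n + 1) := hW ▸ Submodule.mem_top
      exact ht
  rw [Submodule.eq_top_iff']
  -- Every Fock vector is the norm-convergent sum of its homogeneous components, since the exponent
  -- $2$ is finite.
  exact fun f => hN.mem_of_tendsto (lp.hasSum_single (by norm_num) f)
    (Eventually.of_forall fun s => N.sum_mem fun n _ => key n (f n))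

end Fock

end Poisson

end

/-! ### The vacuum state is faithful and normal. -/

theorem proposition3 {H : Type*} [NormedAddCommGroup H] [InnerProductSpace ℂ H] [CompleteSpace H]
    {Θ : Type*} [Countable Θ] [Nontrivial Θ] (e : HilbertBasis Θ ℂ H)
    (ω : Poisson.Weights Θ) (κ : Poisson.FreeUltrafilter) (Ω : ℂ) (hΩ : ‖Ω‖ = 1) :
    Poisson.IsFaithfulNormalState (Poisson.vacuumState e ω κ Ω) := by
  open Poisson PoissonBoundary in
  refine ⟨fun x hx => inner_apply_nonneg (toCLM_nonneg_iff.2 hx) _, ?_, fun x hx h0 => ?_,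
    fun D s hne _ hdir hs => isLUB_image_vectorFunctional (vacuum H Ω) hne hdir hs⟩
  · change inner ℂ (vacuum H Ω) (vacuum H Ω) = (1 : ℂ)
    rw [inner_self_eq_norm_sq_to_K, norm_vacuum, hΩ]
    simp
  · have hx' := toCLM_nonneg_iff.2 hx
    -- Cyclicity is applied to the kernel of $x$: $\varphi(x) = 0$ puts the vacuum in it, and
    -- harmonicity makes it invariant under the creation operators.
    have htop := eq_top_of_vacuum_mem e
      (N := LinearMap.ker (toCLM ω (basisCreation e) κ x).toLinearMap)
      (toCLM ω (basisCreation e) κ x).isClosed_ker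
      (norm_ne_zero_iff.1 (hΩ.symm ▸ one_ne_zero)) (apply_eq_zero_of_nonneg hx' h0)
      fun i f hf => apply_isometry_eq_zero hx' x.toCLM_mem hf i
    refine toCLM_injective (ContinuousLinearMap.ext fun f => ?_)
    have hf : f ∈ LinearMap.ker (toCLM ω (basisCreation e) κ x).toLinearMap :=
      htop ▸ Submodule.mem_top
    exact hf
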